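/- For a finite connected graph $G$ let $D(G)$ be its distance matrix, whose $(u,v)$-entry is the length of a shortest path from $u$ to $v$, and let $\lambda_1(D(G))$ be the largest eigenvalue of $D(G)$. Let $c(G-S)$ be the number of connected components of the subgraph of $G$ induced on $V(G)\setminus S$, and put $$\tau(G)=\min_{S\subset V(G)}\left\{\frac{|S|}{c(G-S)-1} : c(G-S)>1\right\},$$ with $\tau(G)=\infty$ if $G$ is complete (so that no such $S$ exists). For a real number $t>0$, $G$ is called $t$-tough if $\tau(G)\ge t$. Here $\cup$ denotes the disjoint union of graphs, and $\vee$ their join (the disjoint union together with all edges between the two graphs). Let $\tau\ge 2$ be an integer, let $G$ be a connected graph of order $n\ge 4\tau^2+5\tau+1$, and suppose that $$\lambda_1(D(G))\le\lambda_1\bigl(D(K_{\tau-1}\vee(K_{n-\tau}\cup K_1))\bigr).$$ Then $G$ is $\tau$-tough, unless $G\cong K_{\tau-1}\vee(K_{n-\tau}\cup K_1)$, in which case $G$ is not $\tau$-tough. -/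

import Mathlib

open scoped ENNReal

noncomputable section

namespace DistTough

/-- The join `G ∨ H`: the disjoint union of `G` and `H` together with all edges between them. -/
def join {V W : Type*} (G : SimpleGraph V) (H : SimpleGraph W) : SimpleGraph (V ⊕ W) :=
  SimpleGraph.sum G H ⊔ completeBipartiteGraph V W

/-- The graph `K_{τ-1} ∨ (K_{n-τ} ∪ K₁)`, meaningful for `1 ≤ τ ≤ n`. -/
def extremalGraph (n τ : ℕ) : SimpleGraph (Fin (τ - 1) ⊕ (Fin (n - τ) ⊕ Fin 1)) :=
  join (⊤ : SimpleGraph (Fin (τ - 1)))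
    (SimpleGraph.sum (⊤ : SimpleGraph (Fin (n - τ))) (⊤ : SimpleGraph (Fin 1)))

/-- The distance matrix `D(G)`. -/
def distMatrix {V : Type*} (G : SimpleGraph V) : Matrix V V ℝ :=
  Matrix.of fun u v => (G.dist u v : ℝ)

theorem distMatrix_isHermitian {V : Type*} (G : SimpleGraph V) : (distMatrix G).IsHermitian := by
  ext u v
  simp [distMatrix, SimpleGraph.dist_comm]

/-- The distance spectral radius `λ₁(D(G))`: the largest eigenvalue of the distance matrix. -/
def distSpectralRadius {V : Type*} [Fintype V] [DecidableEq V] (G : SimpleGraph V) : ℝ :=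
  ⨆ i : V, (distMatrix_isHermitian G).eigenvalues i

/-- `c(G - S)`: the number of connected components of the subgraph induced on the complement
of `S`. -/
def numComponents {V : Type*} (G : SimpleGraph V) (S : Finset V) : ℕ :=
  Nat.card (G.induce ((S : Set V)ᶜ)).ConnectedComponent

/-- The variation of toughness `τ(G) = min { |S| / (c(G - S) - 1) : S ⊆ V(G), c(G - S) > 1 }`.
For a finite non-complete graph the infimum is a minimum over a finite non-empty family; for a
complete graph no `S` is admissible and the value is `∞`, the usual convention. -/
def toughness {V : Type*} (G : SimpleGraph V) : ℝ≥0∞ :=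
  ⨅ (S : Finset V) (_ : 1 < numComponents G S),
    (S.card : ℝ≥0∞) / ((numComponents G S : ℝ≥0∞) - 1)

/-- `G` is `t`-tough (in the sense of the variation of toughness) if `τ(G) ≥ t`. -/
def IsTough {V : Type*} (G : SimpleGraph V) (t : ℝ≥0∞) : Prop :=
  t ≤ toughness G

end DistTough

end

namespace DistTough

open Finset Matrix

/-! ### Rayleigh quotients and Perron–Frobenius for symmetric matrices -/

section Spectral

variable {n : Type*} [Fintype n] [DecidableEq n]

/-! The extremal graph has λ₁ ≤ n + 2 (`distSpectralRadius_extremalGraph_le`), while testing D(G) on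
the all-ones vector gives λ₁ ≥ n - 1 + q/n for any q ordered pairs of distinct non-adjacent
vertices. Hence the spectral hypothesis forces q ≤ 3n.

If G is not τ-tough, some S leaves k + 1 ≥ 2 components with |S| < τk. Vertices in different
components are non-adjacent, and counting such pairs gives more than 3n when k ≥ 2
(`three_mul_lt_of_le_two_mul`), and also when k = 1 and both components have at least two vertices.
What remains is an isolated vertex of G - S with |S| ≤ τ - 1: then G is a spanning subgraph of the
extremal graph, whose diameter is at most 2, so D(G) dominates its distance matrix entrywise. Strict
Perron–Frobenius monotonicity (`eq_of_le_of_iSup_eigenvalues_le`) makes the two graphs isomorphic.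
-/

theorem posSemidef_iSup_eigenvalues_smul_one_sub {A : Matrix n n ℝ} (hA : A.IsHermitian) :
    ((⨆ i, hA.eigenvalues i) • (1 : Matrix n n ℝ) - A).PosSemidef := by
  set r := ⨆ i, hA.eigenvalues i
  have hd : (diagonal fun i => r - hA.eigenvalues i).PosSemidef :=
    PosSemidef.diagonal fun i =>
      sub_nonneg.2 (le_ciSup (Set.finite_range hA.eigenvalues).bddAbove i)
  have h := hd.mul_mul_conjTranspose_same (hA.eigenvectorUnitary : Matrix n n ℝ)
  convert h using 1
  have hu : (hA.eigenvectorUnitary : Matrix n n ℝ) * (hA.eigenvectorUnitary : Matrix n n ℝ)ᴴ = 1 :=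
    Unitary.coe_mul_star_self hA.eigenvectorUnitary
  have hs : A = (hA.eigenvectorUnitary : Matrix n n ℝ) * diagonal hA.eigenvalues *
      (hA.eigenvectorUnitary : Matrix n n ℝ)ᴴ := by
    have := hA.spectral_theorem
    rw [Unitary.conjStarAlgAut_apply] at this
    exact this
  have hsplit : (diagonal fun i => r - hA.eigenvalues i) =
      r • (1 : Matrix n n ℝ) - diagonal hA.eigenvalues := by
    rw [smul_one_eq_diagonal, diagonal_sub]
  rw [hsplit, mul_sub, sub_mul, ← hs, mul_smul_comm, mul_one, smul_mul_assoc, hu]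

theorem dotProduct_mulVec_le_iSup_eigenvalues {A : Matrix n n ℝ} (hA : A.IsHermitian)
    (x : n → ℝ) : x ⬝ᵥ A *ᵥ x ≤ (⨆ i, hA.eigenvalues i) * (x ⬝ᵥ x) := by
  have h := (posSemidef_iSup_eigenvalues_smul_one_sub hA).dotProduct_mulVec_nonneg x
  simp only [star_trivial, sub_mulVec, smul_mulVec, one_mulVec, dotProduct_sub,
    dotProduct_smul, smul_eq_mul] at h
  linarith

theorem mulVec_eq_of_dotProduct_mulVec_eq {A : Matrix n n ℝ} (hA : A.IsHermitian) {x : n → ℝ}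
    (hx : x ⬝ᵥ A *ᵥ x = (⨆ i, hA.eigenvalues i) * (x ⬝ᵥ x)) :
    A *ᵥ x = (⨆ i, hA.eigenvalues i) • x := by
  have h := ((posSemidef_iSup_eigenvalues_smul_one_sub hA).dotProduct_mulVec_zero_iff x).1 (by
    simp only [star_trivial, sub_mulVec, smul_mulVec, one_mulVec, dotProduct_sub,
      dotProduct_smul, smul_eq_mul]
    linarith)
  simp only [sub_mulVec, smul_mulVec, one_mulVec] at h
  exact (sub_eq_zero.1 h).symm

/-- Taking absolute values of a top eigenvector does not lower the quadratic form of a nonnegative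
matrix, so the result is still a maximiser, hence an eigenvector. -/
theorem exists_nonneg_eigenvector [Nonempty n] {A : Matrix n n ℝ} (hA : A.IsHermitian)
    (hpos : ∀ i j, 0 ≤ A i j) :
    ∃ x : n → ℝ, x ≠ 0 ∧ (∀ i, 0 ≤ x i) ∧ A *ᵥ x = (⨆ i, hA.eigenvalues i) • x := by
  obtain ⟨k, hk⟩ := exists_eq_ciSup_of_finite (f := hA.eigenvalues)
  set z : n → ℝ := ⇑(hA.eigenvectorBasis k)
  have hAz : A *ᵥ z = (⨆ i, hA.eigenvalues i) • z := by
    rw [← hk]; exact hA.mulVec_eigenvectorBasis k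
  have hz0 : z ≠ 0 := fun h0 => hA.eigenvectorBasis.orthonormal.ne_zero k (by
    ext i; exact congrFun h0 i)
  have hself : (fun i => |z i|) ⬝ᵥ (fun i => |z i|) = z ⬝ᵥ z :=
    Finset.sum_congr rfl fun i _ => abs_mul_abs_self _
  refine ⟨fun i => |z i|, fun h => hz0 ?_, fun i => abs_nonneg _,
    mulVec_eq_of_dotProduct_mulVec_eq hA (le_antisymm
      (dotProduct_mulVec_le_iSup_eigenvalues hA _) ?_)⟩
  · ext i; exact abs_eq_zero.1 (congrFun h i)
  · have : (⨆ i, hA.eigenvalues i) * (z ⬝ᵥ z) = z ⬝ᵥ A *ᵥ z := by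
      rw [hAz, dotProduct_smul, smul_eq_mul]
    rw [hself, this]
    simp only [dotProduct, mulVec, Finset.mul_sum]
    refine Finset.sum_le_sum fun i _ => Finset.sum_le_sum fun j _ => ?_
    calc z i * (A i j * z j) ≤ |z i * (A i j * z j)| := le_abs_self _
      _ = |z i| * (A i j * |z j|) := by rw [abs_mul, abs_mul, abs_of_nonneg (hpos i j)]

/-- Collatz–Wielandt upper bound. -/
theorem iSup_eigenvalues_le_of_mulVec_le [Nonempty n] {A : Matrix n n ℝ} (hA : A.IsHermitian)
    (hpos : ∀ i j, 0 ≤ A i j) {y : n → ℝ} (hy : ∀ i, 0 < y i) {c : ℝ}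
    (hc : ∀ i, (A *ᵥ y) i ≤ c * y i) : (⨆ i, hA.eigenvalues i) ≤ c := by
  obtain ⟨x, hx0, hxn, hAx⟩ := exists_nonneg_eigenvector hA hpos
  have hxy : 0 < x ⬝ᵥ y := by
    obtain ⟨i, hi⟩ := Function.ne_iff.1 hx0
    exact Finset.sum_pos' (fun j _ => mul_nonneg (hxn j) (hy j).le)
      ⟨i, mem_univ _, mul_pos (lt_of_le_of_ne (hxn i) (Ne.symm hi)) (hy i)⟩
  have h1 : x ⬝ᵥ A *ᵥ y = (⨆ i, hA.eigenvalues i) * (x ⬝ᵥ y) := by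
    have hT : Aᵀ = A := by simpa using hA.eq
    rw [dotProduct_mulVec, ← mulVec_transpose, hT, hAx, smul_dotProduct, smul_eq_mul]
  have h2 : x ⬝ᵥ A *ᵥ y ≤ c * (x ⬝ᵥ y) := by
    simp only [dotProduct, Finset.mul_sum]
    refine Finset.sum_le_sum fun i _ => ?_
    calc x i * (A *ᵥ y) i ≤ x i * (c * y i) := mul_le_mul_of_nonneg_left (hc i) (hxn i)
      _ = c * (x i * y i) := by ring
  rw [h1] at h2
  exact le_of_mul_le_mul_right h2 hxy

/-- Strict Perron–Frobenius monotonicity of the spectral radius. -/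
theorem eq_of_le_of_iSup_eigenvalues_le [Nontrivial n] {A : Matrix n n ℝ} (hA : A.IsHermitian)
    (hpos : ∀ i j, 0 ≤ A i j) (hoff : ∀ i j, i ≠ j → 0 < A i j)
    {m : Type*} [Fintype m] [DecidableEq m] {B : Matrix m m ℝ} (hB : B.IsHermitian) (e : m ≃ n)
    (hle : ∀ i j, A (e i) (e j) ≤ B i j)
    (hspec : (⨆ i, hB.eigenvalues i) ≤ ⨆ i, hA.eigenvalues i) (i j : m) :
    A (e i) (e j) = B i j := by
  obtain ⟨x, hx0, hxn, hAx⟩ := exists_nonneg_eigenvector hA hpos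
  set r := ⨆ i, hA.eigenvalues i
  have hxpos : ∀ i, 0 < x i := by
    obtain ⟨k, hk⟩ := Function.ne_iff.1 hx0
    have hk : 0 < x k := lt_of_le_of_ne (hxn k) (Ne.symm hk)
    have hrow : ∀ i, i ≠ k → 0 < r * x i := fun i hi => by
      have h := congrFun hAx i
      simp only [Pi.smul_apply, smul_eq_mul] at h
      rw [← h]
      exact Finset.sum_pos' (fun j _ => mul_nonneg (hpos i j) (hxn j))
        ⟨k, mem_univ _, mul_pos (hoff i k hi) hk⟩
    intro i
    by_cases hi : i = k
    · rwa [hi]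
    · refine lt_of_le_of_ne (hxn i) fun h => ?_
      have := hrow i hi
      rw [← h, mul_zero] at this
      exact lt_irrefl _ this
  -- The Perron vector of `A`, transported along `e`, tests `B`. The assumed spectral inequality
  -- makes the two forms equal; positivity of the vector then gives equality entry by entry.
  have hsum : ∑ i, ∑ j, x (e i) * (A (e i) (e j) * x (e j)) =
      ∑ i, ∑ j, x (e i) * (B i j * x (e j)) := by
    refine le_antisymm (Finset.sum_le_sum fun i _ => Finset.sum_le_sum fun j _ => ?_) ?_
    · exact mul_le_mul_of_nonneg_left (mul_le_mul_of_nonneg_right (hle i j) (hxn _)) (hxn _)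
    · have h1 := dotProduct_mulVec_le_iSup_eigenvalues hB (x ∘ e)
      have h2 : (x ∘ e) ⬝ᵥ (x ∘ e) = x ⬝ᵥ x := Equiv.sum_comp e fun i => x i * x i
      have h3 : ∑ i, ∑ j, x (e i) * (A (e i) (e j) * x (e j)) = r * (x ⬝ᵥ x) := by
        rw [← smul_eq_mul, ← dotProduct_smul, ← hAx]
        simp only [dotProduct, mulVec, Finset.mul_sum]
        rw [← Equiv.sum_comp e]
        exact Finset.sum_congr rfl fun i _ =>
          Equiv.sum_comp e fun j => x (e i) * (A (e i) j * x j)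
      have h4 : 0 ≤ x ⬝ᵥ x := Finset.sum_nonneg fun i _ => mul_self_nonneg _
      rw [h3]
      rw [h2] at h1
      simp only [dotProduct, mulVec, Finset.mul_sum, Function.comp_apply] at h1 ⊢
      refine h1.trans ?_
      rw [← Finset.mul_sum, ← Finset.mul_sum]
      exact mul_le_mul_of_nonneg_right hspec h4
  have hterm : ∀ i j, x (e i) * (A (e i) (e j) * x (e j)) ≤ x (e i) * (B i j * x (e j)) :=
    fun i j => mul_le_mul_of_nonneg_left (mul_le_mul_of_nonneg_right (hle i j) (hxn _)) (hxn _)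
  have h1 := (Finset.sum_eq_sum_iff_of_le fun i _ =>
    Finset.sum_le_sum fun j _ => hterm i j).1 hsum i (mem_univ _)
  have h2 := (Finset.sum_eq_sum_iff_of_le fun j _ => hterm i j).1 h1 j (mem_univ _)
  exact mul_right_cancel₀ (hxpos _).ne' (mul_left_cancel₀ (hxpos _).ne' h2)

end Spectral

/-! ### Pairs separated by a partition with blocks of bounded size -/

section Counting

/-- After subtracting `m` from each term, this is the bound of a sum of squares of nonnegative
numbers by the square of their sum. -/
theorem sum_sq_add_le_of_le {B : Type*} {s : Finset B} {a : B → ℤ} {m : ℤ}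
    (ha : ∀ b ∈ s, m ≤ a b) :
    ∑ b ∈ s, a b ^ 2 ≤
      (∑ b ∈ s, a b - m * #s) ^ 2 + 2 * m * ∑ b ∈ s, a b - m ^ 2 * #s := by
  have h := sum_sq_le_sq_sum_of_nonneg (s := s) (f := fun b => a b - m)
    fun b hb => sub_nonneg.2 (ha b hb)
  have h1 : ∑ b ∈ s, (a b - m) = ∑ b ∈ s, a b - m * #s := by
    rw [sum_sub_distrib, sum_const, nsmul_eq_mul, mul_comm]
  have h2 : ∑ b ∈ s, (a b - m) ^ 2 = ∑ b ∈ s, a b ^ 2 - 2 * m * ∑ b ∈ s, a b + m ^ 2 * #s := by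
    simp only [sub_sq, sum_add_distrib, sum_sub_distrib, sum_const, nsmul_eq_mul, mul_sum]
    rw [mul_comm (m ^ 2)]
    congr 2
    exact sum_congr rfl fun b _ => by ring
  rw [h1, h2] at h
  linarith

theorem card_pairs_eq {A B : Type*} [Fintype A] [Fintype B] [DecidableEq B] (f : A → B) :
    (#{p : A × A | f p.1 = f p.2} : ℤ) = ∑ b, (#{a | f a = b} : ℤ) ^ 2 := by
  rw [card_eq_sum_card_fiberwise (f := fun p : A × A => f p.1) (t := univ) (by simp)]
  push_cast
  refine sum_congr rfl fun b _ => ?_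
  rw [sq, ← Nat.cast_mul, ← card_product]
  congr 2
  ext ⟨x, y⟩
  simp only [mem_filter, mem_univ, true_and, mem_product]
  constructor
  · rintro ⟨h, rfl⟩; exact ⟨rfl, h.symm⟩
  · rintro ⟨rfl, h⟩; exact ⟨h.symm, rfl⟩

/-- A map whose fibres all have at least `m` elements separates many pairs. -/
theorem le_card_separated_pairs {A B : Type*} [Fintype A] [Fintype B] [DecidableEq B]
    (f : A → B) (m : ℕ) (hm : ∀ b, m ≤ #{a | f a = b}) :
    (Fintype.card A : ℤ) ^ 2 - (Fintype.card A - m * Fintype.card B) ^ 2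
      - 2 * m * Fintype.card A + m ^ 2 * Fintype.card B ≤ #{p : A × A | f p.1 ≠ f p.2} := by
  have h1 := sum_sq_add_le_of_le (s := (univ : Finset B))
    (a := fun b => (#{a | f a = b} : ℤ)) (m := m) fun b _ => by exact_mod_cast hm b
  have h2 : ∑ b, (#{a | f a = b} : ℤ) = Fintype.card A := by
    rw [← Finset.card_univ, card_eq_sum_card_fiberwise (f := f) (t := univ) (by simp)]
    push_cast; rfl
  have h3 := card_filter_add_card_filter_not (s := (univ : Finset (A × A)))
    (fun p => f p.1 = f p.2)
  have h4 : (#{p : A × A | f p.1 = f p.2} : ℤ) + #{p : A × A | f p.1 ≠ f p.2} =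
      (Fintype.card A : ℤ) ^ 2 := by
    rw [sq, ← Nat.cast_mul, ← Fintype.card_prod, ← Finset.card_univ]
    exact_mod_cast h3
  rw [card_pairs_eq] at h4
  rw [h2, Finset.card_univ] at h1
  linarith

end Counting

/-! ### The numerical inequality for at least three components -/

section Arithmetic

/-- The right side is the separated-pair count for `k + 1` nonempty components on `n - s` vertices.
For small `k` the binding constraint is `s < τ * k`; for large `k` it is `s + k + 1 ≤ n`. -/
theorem three_mul_lt_of_le_two_mul {n τ k s : ℤ} (hτ : 2 ≤ τ) (hn : 4 * τ ^ 2 + 5 * τ + 1 ≤ n)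
    (hk : 2 ≤ k) (hs : s + 1 ≤ τ * k) (hsk : s + k + 1 ≤ n) :
    3 * n < 2 * (n - s) * k - k ^ 2 - k := by
  by_cases hkn : (τ + 1) * k ≤ n
  · have h1 : 2 * (n - s) * k ≥ 2 * (n - τ * k + 1) * k := by
      have : n - τ * k + 1 ≤ n - s := by linarith
      nlinarith
    suffices h : 0 < n * (2 * k - 3) - (2 * τ + 1) * k ^ 2 + k by nlinarith
    -- Putting `n = (τ + 1) * k` in the goal leaves `k * (k - (3 * τ + 2))`, whence the threshold.
    by_cases hk3 : k ≤ 3 * τ + 2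
    · have h2 : (4 * τ ^ 2 + 5 * τ + 1) * (2 * k - 3) ≤ n * (2 * k - 3) :=
        mul_le_mul_of_nonneg_right hn (by linarith)
      have h3 : 0 ≤ (k - 2) * (3 * τ + 2 - k) := mul_nonneg (by linarith) (by linarith)
      have h4 : 0 ≤ (2 * τ + 1) * ((k - 2) * (3 * τ + 2 - k)) := mul_nonneg (by linarith) h3
      have h5 : 0 ≤ (k - 2) * (τ ^ 2 - 2 * τ) := mul_nonneg (by linarith) (by nlinarith)
      have h6 : 0 ≤ (k - 2) * (τ - 2) := mul_nonneg (by linarith) (by linarith)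
      nlinarith
    · have h2 : (τ + 1) * k * (2 * k - 3) ≤ n * (2 * k - 3) :=
        mul_le_mul_of_nonneg_right hkn (by linarith)
      have h3 : 0 < k * (k - (3 * τ + 2)) := mul_pos (by linarith) (by linarith)
      nlinarith
  · push Not at hkn
    -- The bound on `n` factors as `(4 * τ + 1) * (τ + 1)`.
    have h1 : 4 * τ + 1 < k := by
      by_contra! h
      nlinarith
    have h2 : 2 * (n - s) * k ≥ 2 * (k + 1) * k := by
      have : k + 1 ≤ n - s := by linarith
      nlinarith
    have h3 : 3 * (τ + 1) * k < (k + 1) * k :=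
      mul_lt_mul_of_pos_right (by linarith) (by linarith)
    nlinarith

end Arithmetic

/-! ### Comparing distance matrices -/

section Distance

variable {V W : Type*}

theorem distMatrix_nonneg (G : SimpleGraph V) (u v : V) : 0 ≤ distMatrix G u v :=
  Nat.cast_nonneg _

/-- Distinct non-adjacent vertices of `G` are at distance at least 2, already the maximum in `H`. -/
theorem dist_le_of_le_of_dist_le_two {G : SimpleGraph V} {H : SimpleGraph W}
    (hG : G.Connected) (e : V ≃ W)
    (he : ∀ u v, G.Adj u v → H.Adj (e u) (e v)) (h2 : ∀ a b, H.dist a b ≤ 2) (u v : V) :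
    H.dist (e u) (e v) ≤ G.dist u v := by
  by_cases huv : u = v
  · simp [huv]
  by_cases hadj : G.Adj u v
  · rw [SimpleGraph.dist_eq_one_iff_adj.2 hadj, SimpleGraph.dist_eq_one_iff_adj.2 (he u v hadj)]
  · exact (h2 _ _).trans (hG.one_lt_dist_of_ne_of_not_adj huv hadj)

/-- If `G` embeds as a spanning subgraph of a graph `H` of diameter at most two, then its distance
spectral radius is at least that of `H`, with equality only if `G ≅ H`. -/
theorem nonempty_iso_of_distSpectralRadius_le [Fintype V] [DecidableEq V] [Fintype W]
    [DecidableEq W] [Nontrivial W] {G : SimpleGraph V} {H : SimpleGraph W}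
    (hG : G.Connected) (hH : H.Connected) (e : V ≃ W)
    (he : ∀ u v, G.Adj u v → H.Adj (e u) (e v)) (h2 : ∀ a b, H.dist a b ≤ 2)
    (hspec : distSpectralRadius G ≤ distSpectralRadius H) : Nonempty (G ≃g H) := by
  have h := eq_of_le_of_iSup_eigenvalues_le (distMatrix_isHermitian H) (distMatrix_nonneg H)
    (fun a b hab => Nat.cast_pos.2 (hH.pos_dist_of_ne hab)) (distMatrix_isHermitian G) e
    (fun u v => Nat.cast_le.2 (dist_le_of_le_of_dist_le_two hG e he h2 u v)) hspec
  refine ⟨⟨e, fun {u v} => ?_⟩⟩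
  have huv : H.dist (e u) (e v) = G.dist u v := Nat.cast_injective (h u v)
  rw [← SimpleGraph.dist_eq_one_iff_adj, ← SimpleGraph.dist_eq_one_iff_adj, huv]

/-- Lower bound for the distance spectral radius by the average transmission, counting a set of
pairs of distinct non-adjacent vertices. -/
theorem card_nonadj_le_mul_distSpectralRadius [Fintype V] [DecidableEq V] {G : SimpleGraph V}
    (hG : G.Connected) (Q : Finset (V × V)) (hQ : ∀ p ∈ Q, p.1 ≠ p.2 ∧ ¬ G.Adj p.1 p.2) :
    (Fintype.card V : ℝ) * (Fintype.card V - 1) + #Q ≤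
      distSpectralRadius G * Fintype.card V := by
  have h1 := dotProduct_mulVec_le_iSup_eigenvalues (distMatrix_isHermitian G) fun _ => (1 : ℝ)
  simp only [dotProduct, mulVec, mul_one, one_mul, sum_const, Finset.card_univ, nsmul_eq_mul] at h1
  refine le_trans ?_ h1
  have hterm : ∀ u v, (1 : ℝ) - (if u = v then 1 else 0) + (if (u, v) ∈ Q then 1 else 0) ≤
      distMatrix G u v := by
    intro u v
    change _ ≤ (G.dist u v : ℝ)
    by_cases huv : u = v
    · subst huv
      have : (u, u) ∉ Q := fun h => (hQ _ h).1 rfl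
      simp [this]
    · by_cases hq : (u, v) ∈ Q
      · have : ((2 : ℕ) : ℝ) ≤ G.dist u v :=
          Nat.cast_le.2 (hG.one_lt_dist_of_ne_of_not_adj huv (hQ _ hq).2)
        simp only [huv, hq, if_true, if_false]
        push_cast at this
        linarith
      · have : ((1 : ℕ) : ℝ) ≤ G.dist u v := Nat.cast_le.2 (hG.pos_dist_of_ne huv)
        simp only [huv, hq, if_false]
        push_cast at this
        linarith
  refine le_trans (le_of_eq ?_) (sum_le_sum fun u _ => sum_le_sum fun v _ => hterm u v)
  have hcard : (∑ u, ∑ v, if (u, v) ∈ Q then (1 : ℝ) else 0) = #Q := by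
    rw [← Fintype.sum_prod_type' fun u v => if (u, v) ∈ Q then (1 : ℝ) else 0]
    simp
  simp only [sum_add_distrib, sum_sub_distrib, hcard]
  simp
  ring

end Distance

/-! ### The extremal graph: spectral bound and embedding -/

section Extremal

variable {n τ : ℕ}

theorem extremalGraph_adj_inl (a : Fin (τ - 1)) {b : Fin (τ - 1) ⊕ (Fin (n - τ) ⊕ Fin 1)}
    (h : Sum.inl a ≠ b) : (extremalGraph n τ).Adj (Sum.inl a) b := by
  rcases b with b | b
  · have : a ≠ b := fun hab => h (by rw [hab])
    simpa [extremalGraph, join] using this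
  · simp [extremalGraph, join]

theorem extremalGraph_adj_inr_inl {a b : Fin (n - τ)} (h : a ≠ b) :
    (extremalGraph n τ).Adj (Sum.inr (Sum.inl a)) (Sum.inr (Sum.inl b)) := by
  simpa [extremalGraph, join] using h

theorem extremalGraph_not_adj (a : Fin (n - τ)) (b : Fin 1) :
    ¬ (extremalGraph n τ).Adj (Sum.inr (Sum.inl a)) (Sum.inr (Sum.inr b)) := by
  simp [extremalGraph, join]

theorem extremalGraph_connected (hτ : 2 ≤ τ) : (extremalGraph n τ).Connected := by
  have : ∀ b, (extremalGraph n τ).Reachable (Sum.inl ⟨0, by omega⟩) b := fun b => by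
    by_cases h : Sum.inl ⟨0, by omega⟩ = b
    · rw [h]
    · exact (extremalGraph_adj_inl _ h).reachable
  exact (SimpleGraph.connected_iff _).2
    ⟨fun a b => (this a).symm.trans (this b), ⟨Sum.inl ⟨0, by omega⟩⟩⟩

theorem extremalGraph_dist_le_two (hτ : 2 ≤ τ) (a b) : (extremalGraph n τ).dist a b ≤ 2 := by
  have : ∀ b, (extremalGraph n τ).dist (Sum.inl ⟨0, by omega⟩) b ≤ 1 := fun b => by
    by_cases h : Sum.inl ⟨0, by omega⟩ = b
    · simp [h]
    · exact (SimpleGraph.dist_eq_one_iff_adj.2 (extremalGraph_adj_inl _ h)).le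
  have h1 := this a
  have h2 := this b
  rw [SimpleGraph.dist_comm] at h1
  exact ((extremalGraph_connected hτ).dist_triangle (v := Sum.inl ⟨0, by omega⟩)).trans (by omega)

theorem extremalGraph_dist_le_one {a b} (h : a ≠ b → (extremalGraph n τ).Adj a b) :
    ((extremalGraph n τ).dist a b : ℝ) ≤ if a = b then 0 else 1 := by
  by_cases hab : a = b
  · simp [hab]
  · simp [hab, SimpleGraph.dist_eq_one_iff_adj.2 (h hab)]

/-- Collatz–Wielandt with weight 2 on the `K₁` vertex, whose transmission is nearly `2 * n`, and 1
elsewhere. The weighted row sums are at most `n`, `n + 2` and `2 * n - τ - 1`. -/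
theorem distSpectralRadius_extremalGraph_le (hτ : 2 ≤ τ) (hn : τ ≤ n) :
    distSpectralRadius (extremalGraph n τ) ≤ n + 2 := by
  have : Nonempty (Fin (τ - 1) ⊕ (Fin (n - τ) ⊕ Fin 1)) := ⟨Sum.inr (Sum.inr 0)⟩
  have hτ1 : ((τ - 1 : ℕ) : ℝ) = τ - 1 := by rw [Nat.cast_sub (by omega), Nat.cast_one]
  have hnτ : ((n - τ : ℕ) : ℝ) = n - τ := Nat.cast_sub hn
  have hn' : (τ : ℝ) ≤ n := Nat.cast_le.2 hn
  have hτ' : (2 : ℝ) ≤ τ := by exact_mod_cast hτ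
  have h2 : ∀ a b, ((extremalGraph n τ).dist a b : ℝ) ≤ 2 := fun a b => by
    exact_mod_cast extremalGraph_dist_le_two hτ a b
  refine iSup_eigenvalues_le_of_mulVec_le (distMatrix_isHermitian _) (distMatrix_nonneg _)
    (y := Sum.elim 1 (Sum.elim 1 2)) ?_ ?_
  · rintro (i | i | i) <;> simp
  have key : ∀ i (g : Fin (τ - 1) ⊕ (Fin (n - τ) ⊕ Fin 1) → ℝ),
      (∀ j, ((extremalGraph n τ).dist i j : ℝ) ≤ g j) →
      (distMatrix (extremalGraph n τ) *ᵥ Sum.elim 1 (Sum.elim 1 2)) i ≤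
      ∑ j, g (Sum.inl j) + (∑ j, g (Sum.inr (Sum.inl j)) + 2 * g (Sum.inr (Sum.inr 0))) := by
    intro i g hg
    simp only [mulVec, dotProduct, Fintype.sum_sum_type, Sum.elim_inl, Sum.elim_inr,
      mul_one, Fin.sum_univ_one, Pi.ofNat_apply]
    rw [mul_comm _ (2 : ℝ)]
    exact add_le_add (sum_le_sum fun j _ => hg _) (add_le_add (sum_le_sum fun j _ => hg _)
      (mul_le_mul_of_nonneg_left (hg _) zero_le_two))
  rintro (i | i | i)
  · refine (key _ (fun j => if Sum.inl i = j then 0 else 1) fun j =>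
      extremalGraph_dist_le_one (extremalGraph_adj_inl i)).trans ?_
    have h : ∑ j : Fin (τ - 1), (if i = j then (0 : ℝ) else 1) ≤ τ - 1 := by
      calc _ ≤ ∑ j : Fin (τ - 1), (1 : ℝ) := sum_le_sum fun j _ => by split_ifs <;> norm_num
        _ = τ - 1 := by simp [hτ1]
    simp [hnτ]
    linarith
  · refine (key _ (Sum.elim (fun _ => 1)
      (Sum.elim (fun j => if i = j then 0 else 1) (fun _ => 2))) ?_).trans ?_
    · rintro (j | j | j)
      · rw [SimpleGraph.dist_comm]
        exact (extremalGraph_dist_le_one (extremalGraph_adj_inl j)).trans (by simp)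
      · refine (extremalGraph_dist_le_one fun h => extremalGraph_adj_inr_inl fun hij =>
          h (by rw [hij])).trans (by simp)
      · exact h2 _ _
    · have h : ∑ j : Fin (n - τ), (if i = j then (0 : ℝ) else 1) = n - τ - 1 := by
        have : ∀ j, (if i = j then (0 : ℝ) else 1) = 1 - if i = j then 1 else 0 := fun j => by
          split_ifs <;> norm_num
        simp only [this, sum_sub_distrib]
        simp [hnτ]
      simp [h, hτ1]
      linarith
  · refine (key _ (Sum.elim (fun _ => 1) (Sum.elim (fun _ => 2) (fun _ => 0))) ?_).trans ?_
    · rintro (j | j | j)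
      · rw [SimpleGraph.dist_comm]
        exact (extremalGraph_dist_le_one (extremalGraph_adj_inl j)).trans (by simp)
      · exact h2 _ _
      · simp [Subsingleton.elim i j]
    · simp [hnτ, hτ1]
      linarith

/-- A graph with a vertex of degree less than `τ` embeds in the extremal graph. -/
theorem exists_equiv_extremalGraph (hτ : 2 ≤ τ) {V : Type*} [Fintype V] [DecidableEq V]
    {G : SimpleGraph V} (hcard : Fintype.card V = n) (hn : τ ≤ n) {v : V} {S : Finset V}
    (hS : #S ≤ τ - 1) (hvS : v ∉ S) (hv : ∀ u, G.Adj u v → u ∈ S) :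
    ∃ e : V ≃ Fin (τ - 1) ⊕ (Fin (n - τ) ⊕ Fin 1),
      ∀ u w, G.Adj u w → (extremalGraph n τ).Adj (e u) (e w) := by
  -- Pad `S` to exactly `τ - 1` vertices avoiding `v`; `T` becomes the join clique, `v` the `K₁`,
  -- the rest `K_{n-τ}`.
  obtain ⟨T, hST, hTv, hT⟩ := exists_subsuperset_card_eq (s := S) (t := univ.erase v) (n := τ - 1)
    (fun x hx => mem_erase.2 ⟨fun h => hvS (h ▸ hx), mem_univ _⟩) hS (by
      rw [card_erase_of_mem (mem_univ _), Finset.card_univ]; omega)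
  have hvT : v ∉ T := fun h => (mem_erase.1 (hTv h)).1 rfl
  have e₁ : {x // x ∈ T} ≃ Fin (τ - 1) := Fintype.equivFinOfCardEq (by simp [hT])
  have e₃ : {y : {x // x ∉ T} // ¬ (y : V) ≠ v} ≃ Fin 1 := Fintype.equivFinOfCardEq (by
    rw [Fintype.card_eq_one_iff]
    exact ⟨⟨⟨v, hvT⟩, by simp⟩, fun y => Subtype.ext (Subtype.ext (not_not.1 y.2))⟩)
  have e₂ : {y : {x // x ∉ T} // (y : V) ≠ v} ≃ Fin (n - τ) := Fintype.equivFinOfCardEq (by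
    have h1 := Fintype.card_congr (Equiv.sumCompl fun y : {x // x ∉ T} => (y : V) ≠ v)
    have h2 := Fintype.card_congr (Equiv.sumCompl fun x => x ∈ T)
    rw [Fintype.card_sum] at h1 h2
    have h3 := Fintype.card_congr e₁
    have h4 := Fintype.card_congr e₃
    rw [Fintype.card_fin] at h3 h4
    omega)
  let e : V ≃ Fin (τ - 1) ⊕ (Fin (n - τ) ⊕ Fin 1) :=
    (Equiv.sumCompl fun x => x ∈ T).symm.trans (Equiv.sumCongr e₁
      ((Equiv.sumCompl fun y : {x // x ∉ T} => (y : V) ≠ v).symm.trans (Equiv.sumCongr e₂ e₃)))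
  have hinl : ∀ a, e.symm (Sum.inl a) ∈ T := fun a => (e₁.symm a).2
  have hinr : ∀ a, e.symm (Sum.inr (Sum.inr a)) = v := fun a => not_not.1 (e₃.symm a).2
  have hadj : ∀ a b, G.Adj (e.symm a) (e.symm b) → (extremalGraph n τ).Adj a b := by
    have hv' : ∀ a b, ¬ G.Adj (e.symm (Sum.inr (Sum.inl a))) (e.symm (Sum.inr (Sum.inr b))) :=
      fun a b h => by
        rw [hinr] at h
        exact (e₂.symm a).1.2 (hST (hv _ h))
    intro a b h
    have hab : a ≠ b := fun hab => h.ne (by rw [hab])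
    rcases a with a | a | a
    · exact extremalGraph_adj_inl a hab
    · rcases b with b | b | b
      · exact (extremalGraph_adj_inl b hab.symm).symm
      · exact extremalGraph_adj_inr_inl fun hh => hab (by rw [hh])
      · exact absurd h (hv' a b)
    · rcases b with b | b | b
      · exact (extremalGraph_adj_inl b hab.symm).symm
      · exact absurd h.symm (hv' b a)
      · exact absurd (by rw [Subsingleton.elim a b]) hab
  exact ⟨e, fun u w h => hadj _ _ (by simpa using h)⟩

end Extremal

/-! ### Toughness and components of G - S -/

section Toughness

variable {V : Type*}

theorem not_isTough_iff {G : SimpleGraph V} {t : ℕ} :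
    ¬ IsTough G (t : ℝ≥0∞) ↔
      ∃ S : Finset V, 1 < numComponents G S ∧ #S < t * (numComponents G S - 1) := by
  simp only [IsTough, toughness, le_iInf_iff, not_forall, not_le, exists_prop]
  refine exists_congr fun S => and_congr_right fun hc => ?_
  have hsub : (numComponents G S : ℝ≥0∞) - 1 = ((numComponents G S - 1 : ℕ) : ℝ≥0∞) := by
    rw [ENNReal.natCast_sub, Nat.cast_one]
  rw [hsub, ENNReal.div_lt_iff (Or.inl (Nat.cast_ne_zero.2 (Nat.sub_ne_zero_of_lt hc)))
    (Or.inl (ENNReal.natCast_ne_top _))]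
  exact_mod_cast Iff.rfl

theorem numComponents_map_iso {W : Type*} {G : SimpleGraph V} {H : SimpleGraph W} (e : G ≃g H)
    (S : Finset V) : numComponents G S = numComponents H (S.map e.toEquiv.toEmbedding) := by
  refine Nat.card_congr (SimpleGraph.Iso.connectedComponentEquiv
    ⟨e.toEquiv.subtypeEquiv fun a => ?_, fun {a b} => e.map_rel_iff⟩)
  simp

theorem isTough_of_iso {W : Type*} {G : SimpleGraph V} {H : SimpleGraph W} (e : G ≃g H)
    {t : ℕ} (hG : IsTough G (t : ℝ≥0∞)) : IsTough H (t : ℝ≥0∞) := by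
  by_contra h
  obtain ⟨S, h1, h2⟩ := not_isTough_iff.1 h
  rw [numComponents_map_iso e.symm] at h1 h2
  exact not_isTough_iff.2 ⟨_, h1, by rwa [card_map]⟩ hG

theorem not_isTough_extremalGraph {n τ : ℕ} (hτ : 2 ≤ τ) (hn : τ < n) :
    ¬ IsTough (extremalGraph n τ) (τ : ℝ≥0∞) := by
  rw [not_isTough_iff]
  set S : Finset (Fin (τ - 1) ⊕ (Fin (n - τ) ⊕ Fin 1)) := univ.map Function.Embedding.inl
  have hmem : ∀ b : Fin (n - τ) ⊕ Fin 1, (Sum.inr b : Fin (τ - 1) ⊕ _) ∈ (S : Set _)ᶜ :=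
    fun b => by simp [S]
  have hc : 1 < numComponents (extremalGraph n τ) S := by
    unfold numComponents
    rw [Finite.one_lt_card_iff_nontrivial]
    refine ⟨SimpleGraph.connectedComponentMk _ ⟨Sum.inr (Sum.inl ⟨0, by omega⟩), hmem _⟩,
      SimpleGraph.connectedComponentMk _ ⟨Sum.inr (Sum.inr 0), hmem _⟩, fun h => ?_⟩
    -- The walk is reversed to start at the `K₁` vertex, so its first edge is already impossible.
    obtain ⟨w⟩ := (SimpleGraph.ConnectedComponent.exact h).symm
    cases w with
    | @cons _ v _ hadj _ =>
      obtain ⟨v | v | v, hv⟩ := v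
      · simp [S] at hv
      · exact extremalGraph_not_adj v 0 hadj.symm
      · exact hadj.ne (Subtype.ext (congrArg (Sum.inr ∘ Sum.inr) (Subsingleton.elim 0 v)))
  refine ⟨S, hc, ?_⟩
  have hS : #S = τ - 1 := by simp [S]
  rw [hS]
  calc τ - 1 < τ * 1 := by omega
    _ ≤ _ := Nat.mul_le_mul_left _ (by omega)

/-- Lower bound for the distance spectral radius in terms of the order of `G - S`, the number of its
components and a lower bound `m` for their orders. -/
theorem numComponents_le_mul_distSpectralRadius [Fintype V] [DecidableEq V]
    {G : SimpleGraph V} (hG : G.Connected) (S : Finset V) (m : ℕ)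
    (hm : ∀ c : (G.induce ((S : Set V)ᶜ)).ConnectedComponent, m ≤ Nat.card c.supp) {N : ℤ}
    (hN : N = Fintype.card V - #S) :
    (Fintype.card V : ℝ) * (Fintype.card V - 1) +
      (N ^ 2 - (N - m * numComponents G S) ^ 2 - 2 * m * N + m ^ 2 * numComponents G S : ℤ) ≤
      distSpectralRadius G * Fintype.card V := by
  classical
  set H := G.induce ((S : Set V)ᶜ)
  have : Fintype ((S : Set V)ᶜ : Set V) := Fintype.ofFinite _
  have : Fintype H.ConnectedComponent := Fintype.ofFinite _
  have hA : (Fintype.card ((S : Set V)ᶜ : Set V) : ℤ) = N := by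
    have h1 : Fintype.card ((S : Set V)ᶜ : Set V) = #Sᶜ := by
      rw [← Set.toFinset_card]; congr 1; ext; simp
    rw [h1, card_compl, hN, Nat.cast_sub (card_le_univ S)]
  have hB : Fintype.card H.ConnectedComponent = numComponents G S :=
    (Nat.card_eq_fintype_card).symm
  have h1 := le_card_separated_pairs H.connectedComponentMk m fun c => by
    refine (hm c).trans_eq ?_
    rw [Nat.card_eq_fintype_card, Fintype.card_subtype]
    exact congrArg card (filter_congr fun _ _ => Iff.rfl)
  rw [hA, hB] at h1
  set P : Finset (((S : Set V)ᶜ : Set V) × ((S : Set V)ᶜ : Set V)) :=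
    {p | H.connectedComponentMk p.1 ≠ H.connectedComponentMk p.2}
  let ι : ((S : Set V)ᶜ : Set V) × ((S : Set V)ᶜ : Set V) ↪ V × V :=
    (Function.Embedding.subtype _).prodMap (Function.Embedding.subtype _)
  have h2 := card_nonadj_le_mul_distSpectralRadius hG (P.map ι) (by
    intro p hp
    obtain ⟨⟨a, b⟩, hab, rfl⟩ := mem_map.1 hp
    have hab := (mem_filter.1 hab).2
    refine ⟨fun h => hab ?_, fun h => hab ?_⟩
    · have : a = b := Subtype.ext h
      rw [this]
    · exact SimpleGraph.ConnectedComponent.sound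
        (SimpleGraph.Adj.reachable (G := H) (u := a) (v := b) h))
  rw [card_map] at h2
  have h3 : ((N ^ 2 - (N - m * numComponents G S) ^ 2 - 2 * m * N +
      m ^ 2 * numComponents G S : ℤ) : ℝ) ≤ #P := by exact_mod_cast h1
  linarith

end Toughness

end DistTough

/-! ### The case analysis -/

theorem theorem2 (n τ : ℕ) (hτ : 2 ≤ τ) (hn : 4 * τ ^ 2 + 5 * τ + 1 ≤ n)
    {V : Type*} [Fintype V] [DecidableEq V] (G : SimpleGraph V)
    (hcard : Fintype.card V = n) (hconn : G.Connected)
    (hspec : DistTough.distSpectralRadius G ≤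
      DistTough.distSpectralRadius (DistTough.extremalGraph n τ)) :
    DistTough.IsTough G (τ : ℝ≥0∞) ↔ ¬ Nonempty (G ≃g DistTough.extremalGraph n τ) := by
  have hτn : 13 * τ + 1 ≤ n := by nlinarith
  refine ⟨fun h ⟨e⟩ => DistTough.not_isTough_extremalGraph hτ (by omega)
    (DistTough.isTough_of_iso e h), fun hiso => by_contra fun htough => ?_⟩
  obtain ⟨S, hc, hS⟩ := DistTough.not_isTough_iff.1 htough
  have hρ := hspec.trans (DistTough.distSpectralRadius_extremalGraph_le hτ (by omega))
  have hn0 : (0 : ℝ) ≤ n := Nat.cast_nonneg n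
  have bound : ∀ q : ℤ, (n : ℝ) * (n - 1) + q ≤ DistTough.distSpectralRadius G * n →
      q ≤ 3 * n := fun q hq => by
    have := mul_le_mul_of_nonneg_right hρ hn0
    have : (q : ℝ) ≤ 3 * n := by linarith
    exact_mod_cast this
  obtain ⟨k, hk⟩ : ∃ k, DistTough.numComponents G S = k + 1 := ⟨_, (Nat.succ_pred (by omega)).symm⟩
  have hSn : S.card + (k + 1) ≤ n := by
    have h1 : DistTough.numComponents G S ≤ Nat.card ((S : Set V)ᶜ : Set V) :=
      Nat.card_le_card_of_surjective _ Quot.mk_surjective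
    rw [← Set.ncard_coe_finset, ← hk, ← hcard, ← Nat.card_eq_fintype_card,
      ← Set.ncard_add_ncard_compl (S : Set V)]
    exact Nat.add_le_add_left h1 _
  have hpos : ∀ c : (G.induce ((S : Set V)ᶜ)).ConnectedComponent, 1 ≤ Nat.card c.supp := fun c => by
    have : Nonempty c.supp := c.nonempty_supp.to_subtype
    exact Nat.card_pos
  rw [hk, Nat.add_sub_cancel] at hS
  by_cases hk2 : 2 ≤ k
  · have h1 := bound _ (hcard ▸ DistTough.numComponents_le_mul_distSpectralRadius hconn S 1
      hpos rfl)
    have h2 := DistTough.three_mul_lt_of_le_two_mul (n := n) (τ := τ) (k := k) (s := S.card)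
      (by exact_mod_cast hτ) (by exact_mod_cast hn) (by exact_mod_cast hk2)
      (by exact_mod_cast hS) (by exact_mod_cast hSn)
    rw [hk] at h1
    push_cast at h1
    nlinarith
  obtain rfl : k = 1 := by omega
  -- Two components of size at least 2 on `N = n - |S|` vertices separate at least `4 * N - 8`
  -- ordered pairs, more than `3 * n`.
  by_cases h2 : ∀ c : (G.induce ((S : Set V)ᶜ)).ConnectedComponent, 2 ≤ Nat.card c.supp
  · have h1 := bound _ (hcard ▸ DistTough.numComponents_le_mul_distSpectralRadius hconn S 2
      h2 rfl)
    rw [hk] at h1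
    push_cast at h1
    have : (S.card : ℤ) < τ := by omega
    have : (13 * τ + 1 : ℤ) ≤ n := by exact_mod_cast hτn
    nlinarith
  · push Not at h2
    obtain ⟨c, hc1⟩ := h2
    have hcard1 : Nat.card c.supp = 1 := le_antisymm (by omega) (hpos c)
    obtain ⟨⟨⟨v, hv⟩, hvc⟩⟩ := (Nat.card_eq_one_iff_unique.1 hcard1).2
    have hsub := (Nat.card_eq_one_iff_unique.1 hcard1).1
    obtain ⟨e, he⟩ := DistTough.exists_equiv_extremalGraph (G := G) hτ hcard (by omega)
      (S := S) (v := v) (by omega) (by simpa using hv) (fun u hu => by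
        -- A neighbour of `v` outside `S` would share its singleton component.
        by_contra huS
        have huc : (⟨u, by simpa using huS⟩ : ((S : Set V)ᶜ : Set V)) ∈ c.supp :=
          (c.mem_supp_congr_adj (v := ⟨u, by simpa using huS⟩) (w := ⟨v, hv⟩)
            (SimpleGraph.induce_adj.2 hu)).2 hvc
        have := hsub.elim ⟨_, huc⟩ ⟨_, hvc⟩
        simp only [Subtype.mk.injEq] at this
        exact hu.ne this)
    have : Nontrivial (Fin (τ - 1) ⊕ (Fin (n - τ) ⊕ Fin 1)) :=
      ⟨Sum.inl ⟨0, by omega⟩, Sum.inr (Sum.inr 0), by simp⟩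
    exact hiso (DistTough.nonempty_iso_of_distSpectralRadius_le hconn
      (DistTough.extremalGraph_connected hτ) e he (DistTough.extremalGraph_dist_le_two hτ) hspec)
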